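/- Let $n\ge 4$ and let $X$ be the quandle of all transpositions in the symmetric group $\mathbb{S}_n$, with $\sigma\triangleright\tau=\sigma\tau\sigma^{-1}$. Let $H^2(X,\mathbb{C}^\times)=Z^2/B^2$ be the second rack cohomology group of $X$ with trivial coefficients $\mathbb{C}^\times$: here $Z^2$ is the group, under pointwise multiplication, of all $q\colon X\times X\to\mathbb{C}^\times$ with $$q(x\triangleright y,x\triangleright z)\,q(x,z)=q(x,y\triangleright z)\,q(y,z)\qquad\text{for all }x,y,z\in X,$$ and $B^2$ is the subgroup of all maps $(x,y)\mapsto\gamma(y)\,\gamma(x\triangleright y)^{-1}$ with $\gamma\colon X\to\mathbb{C}^\times$. For $\sigma,\tau\in X$ with $\tau=(i\,j)$, $1\le i<j\le n$, let $\chi(\sigma,\tau)=1$ if $\sigma(i)<\sigma(j)$ and $\chi(\sigma,\tau)=-1$ otherwise. Then $\chi\in Z^2$, its class $[\chi]\in H^2(X,\mathbb{C}^\times)$ has order $2$, and $$H^2(X,\mathbb{C}^\times)\simeq\mathbb{C}^\times\times\langle[\chi]\rangle,$$ where $\langle[\chi]\rangle$ is the subgroup of $H^2(X,\mathbb{C}^\times)$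 generated by $[\chi]$. An isomorphism from right to left is $(a,\psi)\mapsto[a]\,\psi$, where $[a]$ is the class of the constant cocycle with value $a$. -/

import Mathlib

open scoped Quandles

/-! Degree-two rack cohomology with trivial coefficients in a multiplicatively written abelian
group `A`: the rack cochain complex `Fun(X, A) → Fun(X², A) → Fun(X³, A)`. -/

section RackCohomology

variable (X : Type*) [Rack X] (A : Type*) [CommGroup A]

/-- The differential from 1-cochains to 2-cochains, `(dγ)(x, y) = γ(y) γ(x ◃ y)⁻¹`. -/
def rackD1 : (X → A) →* (X → X → A) where
  toFun γ := fun x y => γ y / γ (x ◃ y)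
  map_one' := by ext x y; simp
  map_mul' γ δ := by ext x y; simp [mul_div_mul_comm]

/-- The differential from 2-cochains to 3-cochains,
`(dq)(x, y, z) = (q(y, z) q(x ◃ y, x ◃ z)⁻¹) (q(x, z) q(x, y ◃ z)⁻¹)⁻¹`. -/
def rackD2 : (X → X → A) →* (X → X → X → A) where
  toFun q := fun x y z => (q y z / q (x ◃ y) (x ◃ z)) / (q x z / q x (y ◃ z))
  map_one' := by ext x y z; simp
  map_mul' p q := by ext x y z; simp [mul_div_mul_comm]

/-- The group `Z²(X, A)` of rack 2-cocycles. -/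
def rackZ2 : Subgroup (X → X → A) := (rackD2 X A).ker

/-- The group `B²(X, A)` of rack 2-coboundaries. -/
def rackB2 : Subgroup (X → X → A) := (rackD1 X A).range

/-- The second rack cohomology group `H²(X, A) = Z²(X, A) / B²(X, A)`. -/
abbrev rackH2 : Type _ := rackZ2 X A ⧸ (rackB2 X A).subgroupOf (rackZ2 X A)

variable {X A}

/-- The usual form of the 2-cocycle condition. -/
theorem mem_rackZ2_iff (q : X → X → A) :
    q ∈ rackZ2 X A ↔
      ∀ x y z, q (x ◃ y) (x ◃ z) * q x z = q x (y ◃ z) * q y z := by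
  simp only [rackZ2, MonoidHom.mem_ker, rackD2, MonoidHom.coe_mk, OneHom.coe_mk, funext_iff,
    Pi.one_apply, div_eq_one]
  refine forall_congr' fun x => forall_congr' fun y => forall_congr' fun z => ?_
  rw [div_eq_div_iff_mul_eq_mul, eq_comm, mul_comm (q x z), mul_comm (q y z)]

/-- Two successive differentials compose to the trivial map. -/
theorem rackB2_le_rackZ2 : rackB2 X A ≤ rackZ2 X A := by
  rintro _ ⟨γ, rfl⟩
  rw [mem_rackZ2_iff]
  intro x y z
  simp only [rackD1, MonoidHom.coe_mk, OneHom.coe_mk, ← Shelf.self_distrib]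
  rw [div_mul_div_cancel', div_mul_div_cancel']

/-- The class in `H²(X, A)` of a 2-cocycle. -/
def rackClass (q : X → X → A) (hq : q ∈ rackZ2 X A) : rackH2 X A :=
  QuotientGroup.mk ⟨q, hq⟩

theorem const_mem_rackZ2 (a : A) : (fun _ _ : X => a) ∈ rackZ2 X A := by
  rw [mem_rackZ2_iff]
  intros
  rfl

/-- The class in `H²(X, A)` of the constant 2-cocycle with value `a`. -/
def rackConstClass (a : A) : rackH2 X A :=
  rackClass (fun _ _ => a) (const_mem_rackZ2 a)

end RackCohomology

/-- The set of transpositions in the symmetric group on `n` letters. -/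
def Transposition (n : ℕ) : Type := {τ : Equiv.Perm (Fin n) // τ.IsSwap}

namespace Transposition

theorem isSwap_conj {n : ℕ} (σ : Equiv.Perm (Fin n)) {τ : Equiv.Perm (Fin n)} (h : τ.IsSwap) :
    (σ * τ * σ⁻¹).IsSwap := by
  obtain ⟨i, j, hij, rfl⟩ := h
  exact ⟨σ i, σ j, fun h => hij (σ.injective h), (Equiv.swap_apply_apply σ i j).symm⟩

/-- The quandle of transpositions, with `σ ◃ τ = σ τ σ⁻¹`. -/
instance instQuandle (n : ℕ) : Quandle (Transposition n) where
  act σ τ := ⟨σ.1 * τ.1 * σ.1⁻¹, isSwap_conj σ.1 τ.2⟩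
  self_distrib := by
    intro x y z
    apply Subtype.ext
    simp [mul_assoc]
  invAct σ τ := ⟨σ.1⁻¹ * τ.1 * σ.1, by simpa using isSwap_conj σ.1⁻¹ τ.2⟩
  left_inv := fun x y => by
    apply Subtype.ext
    simp [mul_assoc]
  right_inv := fun x y => by
    apply Subtype.ext
    simp [mul_assoc]
  fix := by
    intro x
    apply Subtype.ext
    simp

/-- The sign cocycle: for `τ = (i j)` with `i < j`, the value `χ(σ, τ)` is `1` if `σ i < σ j` and
`-1` otherwise. -/
def chi (n : ℕ) (σ τ : Transposition n) : ℂˣ :=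
  if ∃ i j : Fin n, i < j ∧ τ.1 = Equiv.swap i j ∧ σ.1 i < σ.1 j then 1 else -1

end Transposition

/-!
A cocycle `q` makes each `x` act on `X × A` by `T_x (z, a) = (x ◃ z, q x z * a)`, and the cocycle
condition says that `T_{x ◃ y} T_x = T_x T_y`. Coboundaries are the changes of trivialization. A
cocycle is thus a flat connection over `X`, and its class is determined by its monodromy, that is,
by its values along the loops at a base point `x₀`.

For the transpositions in `S_n` with `n ≥ 4`, the value `q x y` at a commuting pair does not change
under coboundaries (`fixedEval`) nor under conjugation. Commuting pairs form two orbits, equal and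
disjoint pairs, which gives two invariants `e₁`, `e₂` of a class with values in `A`.

* The invariants determine the class (`mem_rackB2_of_apply_eq_one`, `rackH2_ext`). If both are `1`,
  then `q` is `1` at commuting pairs and every `T_x` is an involution. What is left of `q` is a
  transport between transpositions with a common letter. The cocycle condition makes it trivial
  around all triangles, both those of transpositions with one common letter (`transport_trans`) and
  those inside a set of three letters (`transport_triangle`), so it has a potential
  (`exists_potential`), and `q` is the coboundary of this potential.
* The invariants satisfy `e₁ ^ 2 = e₂ ^ 2` (`fixedEval_sq`): as `x` acts as an involution, `T_x ^ 2`
  acts on fibres by scalars, and these depend neither on the fibre nor on `x`.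

Hence `e₁ = ± e₂` when `A = ℂˣ`. The constant cocycle `a` has invariants `(a, a)`, and `χ` has
invariants `(-1, 1)`, so that these classes realize every admissible pair exactly once.
-/

/-! ### Cocycles over an arbitrary rack -/

section Rack

variable {X : Type*} {A : Type*} [CommGroup A]

/-- Read `q(x, ·)` as a transport `T_x` on `X × A` lifting `x ◃ ·`, so that the cocycle condition
is `T_{x ◃ y} T_x = T_x T_y`. If `x` acts as an involution, then `T_x ^ 2` is multiplication by
`q x (x ◃ z) * q x z` in the fibre of `z`. Here this scalar does not depend on `z` within an orbit,
because `T_x ^ 2` commutes with `T_y`. -/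
theorem sq_transport_snd [Rack X] {q : X → X → A} (hq : q ∈ rackZ2 X A)
    (h2 : ∀ x z : X, x ◃ (x ◃ z) = z) (x y z : X) :
    q x (x ◃ (y ◃ z)) * q x (y ◃ z) = q x (x ◃ z) * q x z := by
  rw [mem_rackZ2_iff] at hq
  have h := hq x y z
  have h' := hq x (x ◃ y) (x ◃ z)
  rw [h2, h2, ← Shelf.self_distrib] at h'
  apply mul_right_cancel (b := q y z)
  rw [mul_assoc, ← h, ← mul_assoc, ← h']
  simp only [mul_comm, mul_left_comm]

/-- The scalar by which the square of the transport acts is invariant under simultaneous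
translation, because `T_{y ◃ x} ^ 2` is the conjugate of `T_x ^ 2` by `T_y`. -/
theorem sq_transport_act [Rack X] {q : X → X → A} (hq : q ∈ rackZ2 X A)
    (h2 : ∀ x z : X, x ◃ (x ◃ z) = z) (y x z : X) :
    q (y ◃ x) (y ◃ (x ◃ z)) * q (y ◃ x) (y ◃ z) = q x (x ◃ z) * q x z := by
  rw [mem_rackZ2_iff] at hq
  have h := hq y x z
  have h' := hq y x (x ◃ z)
  rw [h2] at h'
  apply mul_right_cancel (b := q y z)
  rw [mul_assoc, h, ← mul_assoc, h', mul_comm (q y z), mul_right_comm]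

/-- The scalar by which the square of the transport acts is invariant under translation in its
first argument alone. -/
theorem sq_transport_fst [Rack X] {q : X → X → A} (hq : q ∈ rackZ2 X A)
    (h2 : ∀ x z : X, x ◃ (x ◃ z) = z) (y x z : X) :
    q (y ◃ x) ((y ◃ x) ◃ z) * q (y ◃ x) z = q x (x ◃ z) * q x z := by
  have h := sq_transport_act hq h2 y x (y ◃ z)
  rw [Shelf.self_distrib, h2] at h
  rw [h, sq_transport_snd hq h2]

theorem apply_act_act_of_fixed [Rack X] {q : X → X → A} (hq : q ∈ rackZ2 X A) (y : X) {x z : X}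
    (h : x ◃ z = z) : q (y ◃ x) (y ◃ z) = q x z := by
  have := (mem_rackZ2_iff q).1 hq y x z
  rwa [h, mul_comm (q y z), mul_left_inj] at this

/-- If `x` fixes `y`, the value `q x y` depends only on the cohomology class of `q`: this is the
resulting homomorphism `H²(X, A) → A`. -/
def fixedEval [Rack X] {x y : X} (h : x ◃ y = y) : rackH2 X A →* A :=
  QuotientGroup.lift _
    { toFun := fun q : rackZ2 X A => q.1 x y
      map_one' := rfl
      map_mul' := fun _ _ => rfl } <| by
    rintro ⟨q, hq⟩ ⟨γ, hγ⟩
    change q x y = 1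
    have : rackD1 X A γ x y = q x y := congrFun (congrFun hγ x) y
    rw [← this]
    change γ y / γ (x ◃ y) = 1
    rw [h, div_self']

/-- `rackConstClass` as a homomorphism. -/
def rackConstHom (X A : Type*) [Rack X] [CommGroup A] : A →* rackH2 X A where
  toFun := rackConstClass
  map_one' := rfl
  map_mul' _ _ := rfl

end Rack

/-! ### Transpositions -/

namespace Transposition

open Equiv

variable {n : ℕ}

/-- The transposition exchanging two distinct letters. -/
def sw (i j : Fin n) (h : i ≠ j) : Transposition n := ⟨swap i j, i, j, h, rfl⟩

theorem sw_comm (i j : Fin n) (h : i ≠ j) : sw i j h = sw j i h.symm :=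
  Subtype.ext (swap_comm i j)

theorem act_act (x z : Transposition n) : x ◃ (x ◃ z) = z := by
  obtain ⟨_, i, j, hij, rfl⟩ := x
  apply Subtype.ext
  change swap i j * (swap i j * z.1 * (swap i j)⁻¹) * (swap i j)⁻¹ = z.1
  simp [mul_assoc]

theorem act_sw (x : Transposition n) (i j : Fin n) (h : i ≠ j) :
    x ◃ sw i j h = sw (x.1 i) (x.1 j) (fun h' => h (x.1.injective h')) :=
  Subtype.ext (swap_apply_apply x.1 i j).symm

theorem act_sw_of_disjoint {a b c d : Fin n} (hab : a ≠ b) (hcd : c ≠ d) (hac : a ≠ c)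
    (had : a ≠ d) (hbc : b ≠ c) (hbd : b ≠ d) : sw a b hab ◃ sw c d hcd = sw c d hcd := by
  apply Subtype.ext
  rw [act_sw]
  change swap (swap a b c) (swap a b d) = swap c d
  rw [swap_apply_of_ne_of_ne hac.symm hbc.symm, swap_apply_of_ne_of_ne had.symm hbd.symm]

theorem act_sw_common {a b k : Fin n} (hab : a ≠ b) (hak : a ≠ k) (hbk : b ≠ k) :
    sw a b hab ◃ sw a k hak = sw b k hbk := by
  apply Subtype.ext
  rw [act_sw]
  change swap (swap a b a) (swap a b k) = swap b k
  rw [swap_apply_left, swap_apply_of_ne_of_ne hak.symm hbk.symm]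

/-- The relative position of two transpositions: equal, disjoint, or with one common letter. -/
theorem eq_or_disjoint_or_common (x z : Transposition n) :
    x = z ∨
    (∃ (a b c d : Fin n) (hab : a ≠ b) (hcd : c ≠ d),
      a ≠ c ∧ a ≠ d ∧ b ≠ c ∧ b ≠ d ∧ x = sw a b hab ∧ z = sw c d hcd) ∨
    ∃ (a b k : Fin n) (hab : a ≠ b) (hak : a ≠ k), b ≠ k ∧ x = sw a b hab ∧ z = sw a k hak := by
  obtain ⟨_, a, b, hab, rfl⟩ := x
  obtain ⟨_, c, d, hcd, rfl⟩ := z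
  change sw a b hab = sw c d hcd ∨ _ ∨ ∃ (a' b' k : Fin n) (h₁ : a' ≠ b') (h₂ : a' ≠ k),
    b' ≠ k ∧ sw a b hab = sw a' b' h₁ ∧ sw c d hcd = sw a' k h₂
  by_cases hac : a = c
  · subst hac
    by_cases hbd : b = d
    · subst hbd; exact .inl rfl
    · exact .inr (.inr ⟨a, b, d, hab, hcd, hbd, rfl, rfl⟩)
  by_cases had : a = d
  · subst had
    by_cases hbc : b = c
    · subst hbc; exact .inl (sw_comm _ _ _)
    · exact .inr (.inr ⟨a, b, c, hab, hcd.symm, hbc, rfl, sw_comm _ _ _⟩)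
  by_cases hbc : b = c
  · subst hbc
    exact .inr (.inr ⟨b, a, d, hab.symm, hcd, had, sw_comm _ _ _, rfl⟩)
  by_cases hbd : b = d
  · subst hbd
    exact .inr (.inr ⟨b, a, c, hab.symm, hcd.symm, hac, sw_comm _ _ _, sw_comm _ _ _⟩)
  exact .inr (.inl ⟨a, b, c, d, hab, hcd, hac, had, hbc, hbd, rfl, rfl⟩)

/-- Conjugation of a transposition by an arbitrary permutation. -/
def conj (σ : Perm (Fin n)) (x : Transposition n) : Transposition n :=
  ⟨σ * x.1 * σ⁻¹, isSwap_conj σ x.2⟩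

theorem conj_sw (σ : Perm (Fin n)) (i j : Fin n) (h : i ≠ j) :
    conj σ (sw i j h) = sw (σ i) (σ j) (fun h' => h (σ.injective h')) :=
  Subtype.ext (swap_apply_apply σ i j).symm

/-- Transpositions generate the symmetric group, so invariance under the rack action is invariance
under conjugation by all permutations. -/
theorem apply_conj_conj {B : Type*} {F : Transposition n → Transposition n → B}
    {x z : Transposition n} (h : x ◃ z = z)
    (hF : ∀ y x z : Transposition n, x ◃ z = z → F (y ◃ x) (y ◃ z) = F x z)
    (σ : Perm (Fin n)) : F (conj σ x) (conj σ z) = F x z := by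
  induction σ using Perm.swap_induction_on with
  | one => congr 1
  | swap_mul σ i j hij ih =>
    have key (w : Transposition n) : conj (swap i j * σ) w = sw i j hij ◃ conj σ w := by
      apply Subtype.ext
      change swap i j * σ * w.1 * (swap i j * σ)⁻¹ = swap i j * (σ * w.1 * σ⁻¹) * (swap i j)⁻¹
      simp [mul_assoc]
    rw [key, key, hF _ _ _ ?_, ih]
    apply Subtype.ext
    have h' : x.1 * z.1 * x.1⁻¹ = z.1 := congrArg Subtype.val h
    change σ * x.1 * σ⁻¹ * (σ * z.1 * σ⁻¹) * (σ * x.1 * σ⁻¹)⁻¹ = σ * z.1 * σ⁻¹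
    calc σ * x.1 * σ⁻¹ * (σ * z.1 * σ⁻¹) * (σ * x.1 * σ⁻¹)⁻¹
        = σ * (x.1 * z.1 * x.1⁻¹) * σ⁻¹ := by group
      _ = σ * z.1 * σ⁻¹ := by rw [h']

theorem injective_vec_four {a b c d : Fin n} (hab : a ≠ b) (hac : a ≠ c) (had : a ≠ d)
    (hbc : b ≠ c) (hbd : b ≠ d) (hcd : c ≠ d) : Function.Injective ![a, b, c, d] := by
  intro i j
  fin_cases i <;> fin_cases j <;> simp [*, Ne.symm, eq_comm]

/-- A function that is invariant under the rack action is constant, as transpositions are all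
conjugate. -/
theorem eq_of_act_invariant {B : Type*} {f : Transposition n → B} (hf : ∀ y x, f (y ◃ x) = f x)
    (x y : Transposition n) : f x = f y := by
  obtain ⟨_, a, b, hab, rfl⟩ := x
  obtain ⟨_, c, d, hcd, rfl⟩ := y
  obtain ⟨σ, hσ⟩ := Perm.exists_extending_pair ![a, b] ![c, d]
    (by intro i j; fin_cases i <;> fin_cases j <;> simp [hab, hab.symm])
    (by intro i j; fin_cases i <;> fin_cases j <;> simp [hcd, hcd.symm])
  have h := apply_conj_conj (F := fun x _ => f x) (Quandle.fix (x := sw a b hab))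
    (fun y x _ _ => hf y x) σ
  have h0 : σ a = c := hσ 0
  have h1 : σ b = d := hσ 1
  simp only [conj_sw, h0, h1] at h
  exact h.symm

/-! ### Triviality of a normalized cocycle -/

/-- A cocycle that is trivial at a pair of equal and at a pair of disjoint transpositions is
trivial at all commuting pairs: each kind of pair is a single orbit under conjugation. -/
theorem apply_eq_one_of_fixed {A : Type*} [CommGroup A] {q : Transposition n → Transposition n → A}
    (hq : q ∈ rackZ2 _ A) {p₀ p₁ p₂ p₃ : Fin n} (hp : Function.Injective ![p₀, p₁, p₂, p₃])
    (h01 : p₀ ≠ p₁) (h23 : p₂ ≠ p₃) (hself : q (sw p₀ p₁ h01) (sw p₀ p₁ h01) = 1)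
    (hdisj : q (sw p₂ p₃ h23) (sw p₀ p₁ h01) = 1)
    {x z : Transposition n} (h : x ◃ z = z) : q x z = 1 := by
  obtain rfl | ⟨a, b, c, d, hab, hcd, hac, had, hbc, hbd, rfl, rfl⟩ |
    ⟨a, b, k, hab, hak, hbk, rfl, rfl⟩ := eq_or_disjoint_or_common x z
  · rw [← hself]
    exact eq_of_act_invariant (f := fun x => q x x)
      (fun y x => apply_act_act_of_fixed hq y Quandle.fix) _ _
  · obtain ⟨σ, hσ⟩ := Perm.exists_extending_pair ![c, d, a, b] ![p₀, p₁, p₂, p₃]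
      (injective_vec_four hcd hac.symm hbc.symm had.symm hbd.symm hab) hp
    have := apply_conj_conj (F := q) h (fun y _ _ h => apply_act_act_of_fixed hq y h) σ
    have h0 : σ c = p₀ := hσ 0
    have h1 : σ d = p₁ := hσ 1
    have h2 : σ a = p₂ := hσ 2
    have h3 : σ b = p₃ := hσ 3
    simp only [conj_sw, h0, h1, h2, h3] at this
    rw [← this, hdisj]
  · rw [act_sw_common hab hak hbk] at h
    have := congrArg (fun f : Transposition n => f.1 k) h
    simp only [sw, swap_apply_right] at this
    exact absurd this.symm hab

section Transport

variable {A : Type*} [CommGroup A]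

/-- The transport `q (a b) (a k)` from the transposition `(a k)` to `(b k)`. By convention it is `1`
when `a = b`. -/
def transport (q : Transposition n → Transposition n → A) (a b k : Fin n) : A :=
  if h : a ≠ b ∧ a ≠ k then q (sw a b h.1) (sw a k h.2) else 1

variable {q : Transposition n → Transposition n → A}

@[simp]
theorem transport_self (a k : Fin n) : transport q a a k = 1 := by simp [transport]

theorem transport_of_ne {a b k : Fin n} (hab : a ≠ b) (hak : a ≠ k) :
    transport q a b k = q (sw a b hab) (sw a k hak) := by simp [transport, hab, hak]

theorem transport_mul_swap (hsq : ∀ x z, q x (x ◃ z) * q x z = 1) {a b k : Fin n}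
    (hak : a ≠ k) (hbk : b ≠ k) : transport q b a k * transport q a b k = 1 := by
  by_cases hab : a = b
  · subst hab; simp
  have := hsq (sw a b hab) (sw a k hak)
  rw [act_sw_common hab hak hbk] at this
  rw [transport_of_ne hab hak, transport_of_ne (Ne.symm hab) hbk, sw_comm b a]
  exact this

/-- Transport around the triangle formed by `(j k)`, `(i k)`, `(l k)` is trivial. -/
theorem transport_trans (hq : q ∈ rackZ2 _ A) (hfix : ∀ x z, x ◃ z = z → q x z = 1)
    (hsq : ∀ x z, q x (x ◃ z) * q x z = 1) {i j l k : Fin n} (hik : i ≠ k) (hjk : j ≠ k)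
    (hlk : l ≠ k) : transport q l j k * transport q j i k = transport q l i k := by
  by_cases hij : i = j
  · subst hij; simp
  by_cases hjl : j = l
  · subst hjl; simp
  by_cases hil : i = l
  · subst hil; rw [transport_self, transport_mul_swap hsq hjk hik]
  have h := (mem_rackZ2_iff q).1 hq (sw i j hij) (sw j l hjl) (sw l k hlk)
  have hfixed := act_sw_of_disjoint hij hlk hil hik hjl hjk
  have hxy : sw i j hij ◃ sw j l hjl = sw i l hil := by
    rw [sw_comm i j, act_sw_common (Ne.symm hij) hjl hil]
  have hyz : sw j l hjl ◃ sw l k hlk = sw j k hjk := by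
    rw [sw_comm j l, act_sw_common (Ne.symm hjl) hlk hjk]
  rw [hfix _ _ hfixed, mul_one, hfixed, hxy, hyz] at h
  rw [transport_of_ne (Ne.symm hjl) hlk, transport_of_ne (Ne.symm hij) hjk,
    transport_of_ne (Ne.symm hil) hlk, sw_comm l j, sw_comm j i, sw_comm l i, mul_comm]
  exact h.symm

/-- Transport around the triangle formed by `(i j)`, `(j k)`, `(k i)` is trivial. -/
theorem transport_triangle (hq : q ∈ rackZ2 _ A) (hfix : ∀ x z, x ◃ z = z → q x z = 1)
    {i j k : Fin n} (hij : i ≠ j) (hik : i ≠ k) (hjk : j ≠ k) :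
    transport q i j k * transport q j k i = transport q i k j := by
  have h := (mem_rackZ2_iff q).1 hq (sw i j hij) (sw j k hjk) (sw i j hij)
  rw [hfix _ _ Quandle.fix, mul_one] at h
  have hxy : sw i j hij ◃ sw j k hjk = sw i k hik := by
    rw [sw_comm i j, act_sw_common (Ne.symm hij) hjk hik]
  have hyz : sw j k hjk ◃ sw i j hij = sw i k hik := by
    rw [sw_comm i j, act_sw_common hjk (Ne.symm hij) (Ne.symm hik), sw_comm]
  rw [Quandle.fix, hxy, hyz] at h
  rw [transport_of_ne hij hik, transport_of_ne hjk (Ne.symm hij), transport_of_ne hik hij,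
    sw_comm j i]
  exact h.symm

/-- If transport around triangles is trivial, then transport has a potential: a primitive of `q`
on non-commuting pairs. -/
theorem exists_potential (hq : q ∈ rackZ2 _ A) (hfix : ∀ x z, x ◃ z = z → q x z = 1)
    (hsq : ∀ x z, q x (x ◃ z) * q x z = 1) {o e : Fin n} (hoe : o ≠ e) :
    ∃ γ : Transposition n → A, ∀ (a b k : Fin n) (hak : a ≠ k) (hbk : b ≠ k),
      transport q a b k * γ (sw b k hbk) = γ (sw a k hak) := by
  -- Transport `(i j)` to `(o j)`, and then to the base point `(o e)`.
  let g (i j : Fin n) : A :=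
    if j = o then transport q i e o else transport q i o j * transport q j e o
  have hg_o (i : Fin n) : g i o = transport q i e o := if_pos rfl
  have hg (i : Fin n) {j : Fin n} (h : j ≠ o) :
      g i j = transport q i o j * transport q j e o := if_neg h
  have g_symm {i j : Fin n} (hij : i ≠ j) : g i j = g j i := by
    by_cases hj : j = o
    · subst hj; rw [hg_o, hg _ hij, transport_self, one_mul]
    by_cases hi : i = o
    · subst hi; rw [hg_o, hg _ hj, transport_self, one_mul]
    rw [hg _ hj, hg _ hi, ← transport_trans hq hfix hsq hoe.symm hi hj, ← mul_assoc,
      mul_comm (transport q i o j), ← transport_triangle hq hfix (Ne.symm hij) hj hi]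
  choose s t hst hval using fun x : Transposition n => x.2
  have hγ {i j : Fin n} (hij : i ≠ j) :
      g (s (sw i j hij)) (t (sw i j hij)) = g i j := by
    have h := hst (sw i j hij)
    have h' : swap i j = swap (s (sw i j hij)) (t (sw i j hij)) := hval (sw i j hij)
    generalize s (sw i j hij) = c, t (sw i j hij) = d at h h'
    have h'' : j = swap c d i := by rw [← h', swap_apply_left]
    rw [swap_apply_def] at h''
    split_ifs at h'' with hc hd
    · rw [hc, h'']
    · rw [hd, h'', g_symm h]
    · exact absurd h''.symm hij
  refine ⟨fun x => g (s x) (t x), fun a b k hak hbk => ?_⟩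
  change _ * g _ _ = g _ _
  rw [hγ, hγ]
  by_cases hk : k = o
  · subst hk; rw [hg_o, hg_o, transport_trans hq hfix hsq hoe.symm hbk hak]
  · rw [hg _ hk, hg _ hk, ← mul_assoc, transport_trans hq hfix hsq (Ne.symm hk) hbk hak]

/-- A cocycle that is trivial at a pair of equal and at a pair of disjoint transpositions is a
coboundary. -/
theorem mem_rackB2_of_apply_eq_one (hq : q ∈ rackZ2 _ A) {p₀ p₁ p₂ p₃ : Fin n}
    (hp : Function.Injective ![p₀, p₁, p₂, p₃]) (h01 : p₀ ≠ p₁) (h23 : p₂ ≠ p₃)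
    (hself : q (sw p₀ p₁ h01) (sw p₀ p₁ h01) = 1) (hdisj : q (sw p₂ p₃ h23) (sw p₀ p₁ h01) = 1) :
    q ∈ rackB2 (Transposition n) A := by
  have hfix (x z : Transposition n) (h : x ◃ z = z) : q x z = 1 :=
    apply_eq_one_of_fixed hq hp h01 h23 hself hdisj h
  have hsq (x z : Transposition n) : q x (x ◃ z) * q x z = 1 := by
    rw [eq_of_act_invariant (f := fun z => q x (x ◃ z) * q x z) (sq_transport_snd hq act_act x) z x,
      Quandle.fix, hfix x x Quandle.fix, mul_one]
  obtain ⟨γ, hγ⟩ := exists_potential hq hfix hsq h01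
  refine ⟨γ, funext fun x => funext fun z => ?_⟩
  change γ z / γ (x ◃ z) = q x z
  obtain rfl | ⟨a, b, c, d, hab, hcd, hac, had, hbc, hbd, rfl, rfl⟩ |
    ⟨a, b, k, hab, hak, hbk, rfl, rfl⟩ := eq_or_disjoint_or_common x z
  · rw [Quandle.fix, div_self', hfix _ _ Quandle.fix]
  · have h := act_sw_of_disjoint hab hcd hac had hbc hbd
    rw [h, div_self', hfix _ _ h]
  · rw [act_sw_common hab hak hbk, div_eq_iff_eq_mul, ← transport_of_ne (q := q) hab hak,
      hγ a b k hak hbk]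

end Transport

/-! ### The sign cocycle -/

/-- The order comparison of two letters, with values in the signs `±1` of `ℂˣ`. -/
def ltSign (a b : Fin n) : ℂˣ := if a < b then 1 else -1

@[simp]
theorem ltSign_mul_self (a b : Fin n) : ltSign a b * ltSign a b = 1 := by
  unfold ltSign; split_ifs <;> simp

theorem ltSign_swap {a b : Fin n} (h : a ≠ b) : ltSign b a = -ltSign a b := by
  unfold ltSign
  rcases h.lt_or_gt with h | h <;> simp [h, h.not_gt]

/-- `χ` compares the order of two letters before and after applying `σ`; this form is symmetric
in `i` and `j`, and shows that `χ` is multiplicative along compositions. -/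
theorem chi_sw (σ : Transposition n) (i j : Fin n) (h : i ≠ j) :
    chi n σ (sw i j h) = ltSign (σ.1 i) (σ.1 j) * ltSign i j := by
  have aux {i j : Fin n} (hij : i < j) :
      chi n σ (sw i j hij.ne) = ltSign (σ.1 i) (σ.1 j) * ltSign i j := by
    have hs : ltSign i j = 1 := if_pos hij
    rw [hs, mul_one]
    refine if_congr ⟨?_, fun h => ⟨i, j, hij, rfl, h⟩⟩ rfl rfl
    rintro ⟨k, l, hkl, heq, hlt⟩
    change swap i j = swap k l at heq
    have h' : j = swap k l i := by rw [← heq, swap_apply_left]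
    rw [swap_apply_def] at h'
    split_ifs at h' with hc hd
    · rwa [hc, h']
    · exact absurd (hd ▸ h' ▸ hkl) hij.not_gt
    · exact absurd h'.symm hij.ne
  rcases h.lt_or_gt with hij | hij
  · exact aux hij
  · rw [sw_comm, aux hij]
    rw [ltSign_swap h, ltSign_swap fun h' => h (σ.1.injective h'), neg_mul_neg]

theorem chi_mem_rackZ2 : chi n ∈ rackZ2 (Transposition n) ℂˣ := by
  rw [mem_rackZ2_iff]
  rintro x y ⟨_, i, j, hij, rfl⟩
  change chi n (x ◃ y) (x ◃ sw i j hij) * chi n x (sw i j hij) =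
    chi n x (y ◃ sw i j hij) * chi n y (sw i j hij)
  have hconj (k : Fin n) : (x ◃ y).1 (x.1 k) = x.1 (y.1 k) := by
    change (x.1 * y.1 * x.1⁻¹) (x.1 k) = _
    simp
  simp only [act_sw, chi_sw, hconj]
  rw [mul_assoc, mul_assoc, ← mul_assoc (ltSign (x.1 i) _), ← mul_assoc (ltSign (y.1 i) _),
    ltSign_mul_self, ltSign_mul_self]

theorem chi_self (i j : Fin n) (h : i ≠ j) : chi n (sw i j h) (sw i j h) = -1 := by
  rw [chi_sw]
  change ltSign (swap i j i) (swap i j j) * _ = _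
  rw [swap_apply_left, swap_apply_right, ltSign_swap h, neg_mul, ltSign_mul_self]

theorem chi_of_disjoint {a b c d : Fin n} (hab : a ≠ b) (hcd : c ≠ d) (hac : a ≠ c)
    (had : a ≠ d) (hbc : b ≠ c) (hbd : b ≠ d) : chi n (sw a b hab) (sw c d hcd) = 1 := by
  rw [chi_sw]
  change ltSign (swap a b c) (swap a b d) * _ = _
  rw [swap_apply_of_ne_of_ne hac.symm hbc.symm, swap_apply_of_ne_of_ne had.symm hbd.symm,
    ltSign_mul_self]

/-! ### The second cohomology group -/

/-- A class is determined by its values at a pair of equal and at a pair of disjoint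
transpositions. -/
theorem rackH2_ext {A : Type*} [CommGroup A] {p₀ p₁ p₂ p₃ : Fin n}
    (hp : Function.Injective ![p₀, p₁, p₂, p₃]) {h01 : p₀ ≠ p₁} {h23 : p₂ ≠ p₃}
    {hd : sw p₂ p₃ h23 ◃ sw p₀ p₁ h01 = sw p₀ p₁ h01} {u v : rackH2 (Transposition n) A}
    (hself : fixedEval (Quandle.fix (x := sw p₀ p₁ h01)) u =
      fixedEval (Quandle.fix (x := sw p₀ p₁ h01)) v)
    (hdisj : fixedEval hd u = fixedEval hd v) : u = v := by
  rw [← div_eq_one] at hself hdisj ⊢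
  rw [← map_div] at hself hdisj
  generalize u / v = w at *
  induction w using QuotientGroup.induction_on with
  | H q =>
    exact (QuotientGroup.eq_one_iff q).2
      (mem_rackB2_of_apply_eq_one q.2 hp h01 h23 hself hdisj)

/-- The two invariants of a class have the same square, since all transports have the same
square. -/
theorem fixedEval_sq {A : Type*} [CommGroup A] {x y : Transposition n} (h : x ◃ y = y)
    (u : rackH2 (Transposition n) A) :
    fixedEval h u ^ 2 = fixedEval (Quandle.fix (x := y)) u ^ 2 := by
  induction u using QuotientGroup.induction_on with
  | H q =>
    have := eq_of_act_invariant (f := fun x => q.1 x (x ◃ y) * q.1 x y)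
      (fun w x => sq_transport_fst q.2 act_act w x y) x y
    simp only [h, Quandle.fix] at this
    rw [sq, sq]
    exact this

end Transposition

open Transposition in
theorem theorem5 (n : ℕ) (hn : 4 ≤ n) :
    ∃ hχ : Transposition.chi n ∈ rackZ2 (Transposition n) ℂˣ,
      orderOf (rackClass (Transposition.chi n) hχ) = 2 ∧
      ∃ Φ : ℂˣ × Subgroup.zpowers (rackClass (Transposition.chi n) hχ) ≃*
          rackH2 (Transposition n) ℂˣ,
        ∀ (a : ℂˣ) (ψ : Subgroup.zpowers (rackClass (Transposition.chi n) hχ)),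
          Φ (a, ψ) = rackConstClass a * (ψ : rackH2 (Transposition n) ℂˣ) := by
  refine ⟨chi_mem_rackZ2, ?_⟩
  obtain ⟨p, hp⟩ : ∃ p : Fin 4 → Fin n, Function.Injective p :=
    ⟨Fin.castLE hn, Fin.castLE_injective hn⟩
  have hp' : Function.Injective ![p 0, p 1, p 2, p 3] := by
    convert hp using 1
    ext i
    fin_cases i <;> rfl
  have hne {i j : Fin 4} (h : i ≠ j) : p i ≠ p j := hp.ne h
  have h01 : p 0 ≠ p 1 := hne (by decide)
  have h23 : p 2 ≠ p 3 := hne (by decide)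
  have hd : sw (p 2) (p 3) h23 ◃ sw (p 0) (p 1) h01 = sw (p 0) (p 1) h01 :=
    act_sw_of_disjoint _ _ (hne (by decide)) (hne (by decide)) (hne (by decide)) (hne (by decide))
  let e₁ : rackH2 (Transposition n) ℂˣ →* ℂˣ := fixedEval (Quandle.fix (x := sw (p 0) (p 1) h01))
  let e₂ : rackH2 (Transposition n) ℂˣ →* ℂˣ := fixedEval hd
  have hext {u v} (h₁ : e₁ u = e₁ v) (h₂ : e₂ u = e₂ v) : u = v := rackH2_ext hp' h₁ h₂
  set χ := rackClass (chi n) chi_mem_rackZ2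
  have hχ₁ : e₁ χ = -1 := chi_self _ _ _
  have hχ₂ : e₂ χ = 1 :=
    chi_of_disjoint _ _ (hne (by decide)) (hne (by decide)) (hne (by decide)) (hne (by decide))
  have hconst₁ (a : ℂˣ) : e₁ (rackConstHom _ _ a) = a := rfl
  have hconst₂ (a : ℂˣ) : e₂ (rackConstHom _ _ a) = a := rfl
  let f : ℂˣ × Subgroup.zpowers χ →* rackH2 (Transposition n) ℂˣ :=
    { toFun := fun w => rackConstHom (Transposition n) ℂˣ w.1 * (w.2 : rackH2 (Transposition n) ℂˣ)
      map_one' := by simp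
      map_mul' := fun w w' => by
        simp only [Prod.fst_mul, Prod.snd_mul, Subgroup.coe_mul, map_mul]
        apply hext <;> simp only [map_mul] <;> exact mul_mul_mul_comm _ _ _ _ }
  have hf (w) : f w = rackConstHom (Transposition n) ℂˣ w.1 * (w.2 : rackH2 (Transposition n) ℂˣ) :=
    rfl
  refine ⟨?_, MulEquiv.ofBijective f ⟨?_, ?_⟩, fun a ψ => rfl⟩
  · have : Fact (Nat.Prime 2) := ⟨Nat.prime_two⟩
    refine orderOf_eq_prime (hext (by simp [hχ₁]) (by simp [hχ₂])) fun h => ?_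
    rw [h, map_one] at hχ₁
    simp [Units.ext_iff, eq_neg_iff_add_eq_zero] at hχ₁
  · rintro ⟨a, ψ, k, rfl⟩ ⟨b, φ, l, rfl⟩ h
    rw [hf, hf] at h
    have hab : a = b := by simpa [hχ₂, hconst₂] using congrArg e₂ h
    subst hab
    exact Prod.ext rfl (Subtype.ext
      (hext (by simpa [hconst₁] using congrArg e₁ h) (by simp [hχ₂])))
  · intro u
    have hcase : e₁ u = e₂ u ∨ e₁ u = -e₂ u := by
      simpa [Units.ext_iff] using
        sq_eq_sq_iff_eq_or_eq_neg.1 (congrArg Units.val (fixedEval_sq hd u).symm)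
    rcases hcase with h | h
    · exact ⟨(e₂ u, 1), hext (by simp [hf, h, hconst₁]) (by simp [hf, hconst₂])⟩
    · exact ⟨(e₂ u, ⟨χ, Subgroup.mem_zpowers χ⟩), hext (by simp [hf, h, hconst₁, hχ₁])
        (by simp [hf, hconst₂, hχ₂])⟩
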